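/- Let $n\ge 2$ be an integer and $w>1$ a real number. Let $A(w)$ be the $n\times n$ adjacency matrix of the path on vertices $1,\dots,n$ (all edges of weight $1$) with a loop of weight $w$ at each of the two end vertices, and let $\lambda_1\ge\lambda_2\ge\dots\ge\lambda_n$ be its eigenvalues. For real $t$ let $p(t)=\left|\left(e^{itA(w)}\right)_{1,n}\right|^2$ be the fidelity of state transfer between the end vertices at time $t$, and let $\alpha(t)=t(\lambda_1-\lambda_2)$. Put $$\tau_n=\frac{(w+1)^2(w-1)}{w\left(w^{2\lceil n/2\rceil}-1\right)},\qquad b(x)=\left(\frac{x+\sqrt{x^2-4}}{\sqrt{x^2-4}}+\frac{16}{(n-1)(x^2-4)}\right)^{-1}\quad (x>2).$$ Suppose that $w+\frac1w-\tau_n>2$, and write $b_1=b\left(w+\frac1w\right)$ and $b_2=b\left(w+\frac1w-\tau_n\right)$. (1) Let $t>0$ and $\alpha=\alpha(t)$, and suppose that $p(t)=\gamma^2$ for some real $\gamma\ge 1-b_1-b_2$. Then $$\cos\alpha\le -1+(1-\gamma)\,\frac{b_1+b_2}{b_1b_2}-\frac{(1-\gamma)^2}{2b_1b_2}.$$ Moreover,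 $\alpha$ can be written as $\alpha=(2k+1)\pi+z$ with an integer $k\ge 0$ and a real $z$ with $|z|\le\pi$; and for every such $k$ and $z$, if $$1-(1-\gamma)\,\frac{b_1+b_2}{b_1b_2}+\frac{(1-\gamma)^2}{2b_1b_2}\ge 0,$$ then $$|z|\le\cos^{-1}\left(1-(1-\gamma)\,\frac{b_1+b_2}{b_1b_2}+\frac{(1-\gamma)^2}{2b_1b_2}\right).$$ (2) In particular, high fidelity forces $\alpha$ to be near an odd multiple of $\pi$: for every $\varepsilon>0$ there is $\gamma_0\in[0,1)$ such that, for every $t>0$ with $p(t)\ge\gamma_0^2$, there is an integer $k\ge 0$ with $|\alpha(t)-(2k+1)\pi|<\varepsilon$. -/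

import Mathlib

/-- The adjacency matrix `A(w)` of `P_n^w`: the unweighted path on `n` vertices (here labelled
`0, …, n - 1`) with a loop of weight `w` at each of the two end vertices. -/
noncomputable def loopPathMatrix (n : ℕ) (w : ℝ) : Matrix (Fin n) (Fin n) ℝ :=
  Matrix.of fun i j =>
    if i = j then (if (i : ℕ) = 0 ∨ (i : ℕ) + 1 = n then w else 0)
    else if (i : ℕ) + 1 = j ∨ (j : ℕ) + 1 = i then 1 else 0

theorem loopPathMatrix_isHermitian (n : ℕ) (w : ℝ) : (loopPathMatrix n w).IsHermitian := by
  ext i j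
  by_cases h : i = j
  · subst h
    simp [loopPathMatrix]
  · simp [loopPathMatrix, h, Ne.symm h, or_comm]

/-- The eigenvalues of `A(w)` in nonincreasing order, with multiplicity: index `0` gives the
largest eigenvalue `λ₁`, index `1` the second largest `λ₂`, and so on. -/
noncomputable def loopPathEigenvalue (n : ℕ) (w : ℝ) (j : Fin n) : ℝ :=
  (loopPathMatrix_isHermitian n w).eigenvalues₀ (Fin.cast (Fintype.card_fin n).symm j)

/-- The transition matrix `U(t) = exp (i t A(w))`. -/
noncomputable def loopPathTransition (n : ℕ) (w t : ℝ) : Matrix (Fin n) (Fin n) ℂ :=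
  NormedSpace.exp ((Complex.I * (t : ℂ)) • (loopPathMatrix n w).map Complex.ofReal)

/-- The fidelity of state transfer from vertex `a` to vertex `b` at time `t`, `|U(t)_{a,b}|²`. -/
noncomputable def loopPathFidelity (n : ℕ) (w : ℝ) (a b : Fin n) (t : ℝ) : ℝ :=
  ‖loopPathTransition n w t a b‖ ^ 2

/-- `τ_n = (w+1)²(w-1) / (w (w^{2⌈n/2⌉} - 1))`. -/
noncomputable def loopPathTau (n : ℕ) (w : ℝ) : ℝ :=
  (w + 1) ^ 2 * (w - 1) / (w * (w ^ (2 * ⌈(n : ℝ) / 2⌉₊) - 1))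

/-- The function `b(x)`, for `x > 2` and a path on `n ≥ 2` vertices. -/
noncomputable def loopPathB (n : ℕ) (x : ℝ) : ℝ :=
  ((x + √(x ^ 2 - 4)) / √(x ^ 2 - 4) + 16 / (((n : ℝ) - 1) * (x ^ 2 - 4)))⁻¹

/-! Expand the end-to-end amplitude of `exp (i t A)` in an orthonormal eigenbasis. The eigenvector
of `λ₁` is symmetric under reversing the path and that of `λ₂` antisymmetric, so their contributions
carry opposite signs; all other terms together contribute at most the weight left over at an end
vertex. If the squared end entries of these two vectors are at least `b₁` and `b₂`, then `√p` is at
most `|b₁ e^{itλ₁} - b₂ e^{itλ₂}| + 1 - b₁ - b₂`, and the law of cosines turns this into the bound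
on `cos α`.

Both end weights are in fact at least `b (w + 1/w) = b₁` (`norm_loopPathTransition_le`);
monotonicity of `b` then allows `b₂` for the second. With first entry scaled to 1, an upper bound on
the sum of squares is needed. The top vector is positive in the Perron–Frobenius sense, has `μ ≥ w +
1/w`, and lies below an explicit solution of the recurrence (`top_sum_le`). The second is
antisymmetric by a nodal-domain argument (`second_antisymm`), has `μ ≤ w + 1/w`, and decays
geometrically from both ends (`second_sum_le`). -/

/-! ### The eigenvalue equation as a three-term recurrence -/

/-- The eigenvalue equations of the path on `K + 2` vertices with end loops of weight `w`, for a
vector given as a function on `ℕ` of which only the values at `0, …, K + 1` matter. -/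
structure IsLoopPathEigenvector (K : ℕ) (w μ : ℝ) (F : ℕ → ℝ) : Prop where
  left : w * F 0 + F 1 = μ * F 0
  mid : ∀ i < K, F i + F (i + 2) = μ * F (i + 1)
  right : F K + w * F (K + 1) = μ * F (K + 1)

theorem loopPathMatrix_mulVec_left (K : ℕ) (w : ℝ) (F : ℕ → ℝ) :
    (loopPathMatrix (K + 2) w).mulVec (fun j => F j) 0 = w * F 0 + F 1 := by
  have h : ∀ j : Fin (K + 2), loopPathMatrix (K + 2) w 0 j * F j =
      (if (j : ℕ) = 0 then w * F 0 else 0) + (if (j : ℕ) = 1 then F 1 else 0) := by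
    rintro ⟨j, hj⟩
    simp only [loopPathMatrix, Matrix.of_apply, Fin.ext_iff, Fin.val_zero]
    grind
  simp only [Matrix.mulVec, dotProduct, h, Finset.sum_add_distrib]
  rw [Fin.sum_univ_eq_sum_range (fun j => if j = 0 then w * F 0 else 0),
    Fin.sum_univ_eq_sum_range (fun j => if j = 1 then F 1 else 0)]
  simp

theorem loopPathMatrix_mulVec_mid (K : ℕ) (w : ℝ) (F : ℕ → ℝ) (i : ℕ) (hi : i < K) :
    (loopPathMatrix (K + 2) w).mulVec (fun j => F j) ⟨i + 1, by omega⟩ = F i + F (i + 2) := by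
  have h : ∀ j : Fin (K + 2), loopPathMatrix (K + 2) w ⟨i + 1, by omega⟩ j * F j =
      (if (j : ℕ) = i then F i else 0) + (if (j : ℕ) = i + 2 then F (i + 2) else 0) := by
    rintro ⟨j, hj⟩
    simp only [loopPathMatrix, Matrix.of_apply, Fin.mk.injEq]
    grind
  simp only [Matrix.mulVec, dotProduct, h, Finset.sum_add_distrib]
  rw [Fin.sum_univ_eq_sum_range (fun j => if j = i then F i else 0),
    Fin.sum_univ_eq_sum_range (fun j => if j = i + 2 then F (i + 2) else 0)]
  have h1 : i < K + 2 := by omega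
  simp [h1, hi]

theorem loopPathMatrix_mulVec_right (K : ℕ) (w : ℝ) (F : ℕ → ℝ) :
    (loopPathMatrix (K + 2) w).mulVec (fun j => F j) ⟨K + 1, by omega⟩ =
      F K + w * F (K + 1) := by
  have h : ∀ j : Fin (K + 2), loopPathMatrix (K + 2) w ⟨K + 1, by omega⟩ j * F j =
      (if (j : ℕ) = K then F K else 0) + (if (j : ℕ) = K + 1 then w * F (K + 1) else 0) := by
    rintro ⟨j, hj⟩
    simp only [loopPathMatrix, Matrix.of_apply, Fin.mk.injEq]
    grind
  simp only [Matrix.mulVec, dotProduct, h, Finset.sum_add_distrib]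
  rw [Fin.sum_univ_eq_sum_range (fun j => if j = K then F K else 0),
    Fin.sum_univ_eq_sum_range (fun j => if j = K + 1 then w * F (K + 1) else 0)]
  simp

theorem isLoopPathEigenvector_iff (K : ℕ) (w μ : ℝ) (F : ℕ → ℝ) :
    IsLoopPathEigenvector K w μ F ↔
      ∀ i : Fin (K + 2), (loopPathMatrix (K + 2) w).mulVec (fun j => F j) i = μ * F i := by
  constructor
  · rintro h ⟨i, hi⟩
    rcases i with _ | i
    · exact (loopPathMatrix_mulVec_left K w F).trans h.left
    · rcases Nat.lt_or_ge i K with hK | hK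
      · exact (loopPathMatrix_mulVec_mid K w F i hK).trans (h.mid i hK)
      · obtain rfl : i = K := by omega
        exact (loopPathMatrix_mulVec_right i w F).trans h.right
  · intro h
    refine ⟨?_, fun i hi => ?_, ?_⟩
    · rw [← loopPathMatrix_mulVec_left K w F]
      exact h 0
    · rw [← loopPathMatrix_mulVec_mid K w F i hi]
      exact h ⟨i + 1, by omega⟩
    · rw [← loopPathMatrix_mulVec_right K w F]
      exact h ⟨K + 1, by omega⟩

namespace IsLoopPathEigenvector

variable {K : ℕ} {w μ : ℝ} {F G : ℕ → ℝ}

theorem smul (h : IsLoopPathEigenvector K w μ F) (c : ℝ) :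
    IsLoopPathEigenvector K w μ (fun i => c * F i) :=
  ⟨by linear_combination c * h.left, fun i hi => by linear_combination c * h.mid i hi,
    by linear_combination c * h.right⟩

theorem flip (h : IsLoopPathEigenvector K w μ F) :
    IsLoopPathEigenvector K w μ (fun i => F (K + 1 - i)) := by
  refine ⟨?_, fun i hi => ?_, ?_⟩
  · have := h.right
    simp only [Nat.sub_zero, Nat.add_sub_cancel]
    linarith
  · have := h.mid (K - 1 - i) (by omega)
    have e1 : K + 1 - i = K - 1 - i + 2 := by omega
    have e2 : K + 1 - (i + 2) = K - 1 - i := by omega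
    have e3 : K + 1 - (i + 1) = K - 1 - i + 1 := by omega
    rw [e1, e2, e3]
    linarith
  · have := h.left
    have e : K + 1 - K = 1 := by omega
    simp only [Nat.sub_self, e]
    linarith

/-- The left equation fixes the second entry and the middle ones each later entry, so every
eigenspace is a line parametrized by the first entry. -/
theorem eq_of_zero_eq (hF : IsLoopPathEigenvector K w μ F) (hG : IsLoopPathEigenvector K w μ G)
    (h0 : F 0 = G 0) : ∀ i ≤ K + 1, F i = G i := by
  have key : ∀ i ≤ K, F i = G i ∧ F (i + 1) = G (i + 1) := by
    intro i
    induction i with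
    | zero =>
      intro _
      refine ⟨h0, ?_⟩
      have h1 := hF.left
      rw [h0] at h1
      linarith [hG.left]
    | succ i ih =>
      intro hi
      obtain ⟨h1, h2⟩ := ih (by omega)
      refine ⟨h2, ?_⟩
      have h3 := hF.mid i (by omega)
      rw [h1, h2] at h3
      have h4 := hG.mid i (by omega)
      have e : F (i + 2) = G (i + 2) := by linarith
      exact e
  intro i hi
  rcases i with _ | i
  · exact h0
  · exact (key i (by omega)).2

/-- Reversal preserves the one-dimensional eigenspace, hence acts on it by a scalar; reversing twice
shows that the scalar is `±1`. -/
theorem flip_eq (hF : IsLoopPathEigenvector K w μ F) (h0 : F 0 ≠ 0) :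
    (∀ i ≤ K + 1, F (K + 1 - i) = F i) ∨ (∀ i ≤ K + 1, F (K + 1 - i) = -F i) := by
  have h := eq_of_zero_eq hF.flip (hF.smul (F (K + 1) / F 0)) (by simp [h0])
  have h1 := h (K + 1) le_rfl
  simp only [Nat.sub_self] at h1
  have h2 : (F (K + 1) / F 0) * (F (K + 1) / F 0) = 1 := by
    field_simp at h1 ⊢
    linarith
  rcases mul_self_eq_one_iff.mp h2 with h3 | h3
  · left
    intro i hi
    rw [h i hi, h3, one_mul]
  · right
    intro i hi
    rw [h i hi, h3, neg_one_mul]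

end IsLoopPathEigenvector

/-! ### Spectral expansion and Rayleigh quotients -/

theorem exists_orthogonal_eigenvectors {n : ℕ} (A : Matrix (Fin n) (Fin n) ℝ)
    (hA : A.IsHermitian) :
    ∃ V : Matrix (Fin n) (Fin n) ℝ, V * V.transpose = 1 ∧ V.transpose * V = 1 ∧
      ∀ j, A.mulVec (V j) = hA.eigenvalues₀ (Fin.cast (Fintype.card_fin n).symm j) • V j := by
  -- `eigenvectorBasis` is indexed through an arbitrary equivalence; `e` re-sorts it to match the
  -- ordered `eigenvalues₀`.
  let e : Fin n ≃ Fin n :=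
    (finCongr (Fintype.card_fin n).symm).trans (Fintype.equivOfCardEq (Fintype.card_fin _))
  let V : Matrix (Fin n) (Fin n) ℝ := Matrix.of fun j i => hA.eigenvectorBasis (e j) i
  have h1 : V * V.transpose = 1 := by
    ext j k
    have h := orthonormal_iff_ite.mp hA.eigenvectorBasis.orthonormal (e j) (e k)
    simp only [PiLp.inner_apply, RCLike.inner_apply, conj_trivial, e.injective.eq_iff] at h
    rw [Matrix.mul_apply, Matrix.one_apply, ← h]
    exact Finset.sum_congr rfl fun i _ => mul_comm _ _
  refine ⟨V, h1, mul_eq_one_comm.mp h1, fun j => ?_⟩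
  have h := hA.mulVec_eigenvectorBasis (e j)
  have he : hA.eigenvalues (e j) =
      hA.eigenvalues₀ (Fin.cast (Fintype.card_fin n).symm j) := by
    simp [Matrix.IsHermitian.eigenvalues, e]
  rw [← he]
  exact h

section OrthogonalEigenvectors

variable {n : ℕ} {A V : Matrix (Fin n) (Fin n) ℝ} {l : Fin n → ℝ}

theorem mulVec_mulVec_eigenvector
    (hA : A.IsHermitian) (hV : ∀ j, A.mulVec (V j) = l j • V j) (f : Fin n → ℝ) (j : Fin n) :
    V.mulVec (A.mulVec f) j = l j * V.mulVec f j := by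
  have hs : A.transpose = A := by simpa [Matrix.IsHermitian] using hA
  change V j ⬝ᵥ A.mulVec f = l j * (V j ⬝ᵥ f)
  rw [Matrix.dotProduct_mulVec, ← Matrix.mulVec_transpose, hs, hV, smul_dotProduct, smul_eq_mul]

/-- A vector whose Rayleigh quotient is at least `μ`, with components only along eigenvectors of
eigenvalues at most `μ`, is an eigenvector of eigenvalue `μ`. -/
theorem mulVec_eq_smul_of_rayleigh (h2 : V.transpose * V = 1)
    (hA : A.IsHermitian) (hV : ∀ j, A.mulVec (V j) = l j • V j) (f : Fin n → ℝ) (μ : ℝ)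
    (hμ : ∀ j, l j ≤ μ ∨ V j ⬝ᵥ f = 0) (hf : ∀ i, μ * f i * f i ≤ f i * A.mulVec f i) :
    A.mulVec f = μ • f := by
  have hdot : ∀ g : Fin n → ℝ, f ⬝ᵥ g = V.mulVec f ⬝ᵥ V.mulVec g := by
    intro g
    rw [Matrix.dotProduct_mulVec, ← Matrix.mulVec_transpose, Matrix.mulVec_mulVec, h2,
      Matrix.one_mulVec]
  have hc := mulVec_mulVec_eigenvector hA hV f
  have hge : μ * (f ⬝ᵥ f) ≤ f ⬝ᵥ A.mulVec f := by
    simp only [dotProduct, Finset.mul_sum]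
    exact Finset.sum_le_sum fun i _ => by linarith [hf i]
  rw [hdot f, hdot (A.mulVec f)] at hge
  have hnn : ∀ j ∈ Finset.univ, 0 ≤ (μ - l j) * (V.mulVec f j * V.mulVec f j) := by
    intro j _
    rcases hμ j with h | h
    · exact mul_nonneg (by linarith) (mul_self_nonneg _)
    · have : V.mulVec f j = 0 := h
      simp [this]
  have hsum : ∑ j, (μ - l j) * (V.mulVec f j * V.mulVec f j) = 0 := by
    refine le_antisymm ?_ (Finset.sum_nonneg hnn)
    simp only [dotProduct, hc, Finset.mul_sum] at hge
    rw [← sub_nonpos, ← Finset.sum_sub_distrib] at hge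
    refine le_trans (le_of_eq (Finset.sum_congr rfl fun j _ => ?_)) hge
    ring
  have hz := (Finset.sum_eq_zero_iff_of_nonneg hnn).mp hsum
  have hVe : V.mulVec (A.mulVec f) = V.mulVec (μ • f) := by
    ext j
    rw [hc, Matrix.mulVec_smul, Pi.smul_apply, smul_eq_mul]
    rcases mul_eq_zero.mp (hz j (Finset.mem_univ j)) with h | h
    · rw [show l j = μ by linarith]
    · rw [mul_self_eq_zero.mp h]
      simp
  have := congrArg (V.transpose.mulVec) hVe
  simpa only [Matrix.mulVec_mulVec, h2, Matrix.one_mulVec, ← Matrix.mul_assoc, one_mul] using this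

theorem exp_smul_map_ofReal_apply (h1 : V * V.transpose = 1)
    (hV : ∀ j, A.mulVec (V j) = l j • V j) (c : ℂ) (a b : Fin n) :
    NormedSpace.exp (c • A.map Complex.ofReal) a b =
      ∑ j, ((V j a * V j b : ℝ) : ℂ) * Complex.exp (c * l j) := by
  let W : Matrix (Fin n) (Fin n) ℂ := V.map Complex.ofRealHom
  have hW1 : W * W.transpose = 1 := by
    have := congrArg (fun M => M.map Complex.ofRealHom) h1
    simpa [W, Matrix.map_mul, Matrix.transpose_map] using this
  have hW2 : W.transpose * W = 1 := mul_eq_one_comm.mp hW1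
  have hAV : A * V.transpose = V.transpose * Matrix.diagonal l := by
    ext i j
    have := congrFun (hV j) i
    rw [Matrix.mul_diagonal, Matrix.transpose_apply, mul_comm]
    exact this
  have hAW : A.map Complex.ofRealHom * W.transpose =
      W.transpose * Matrix.diagonal (fun j => (l j : ℂ)) := by
    have := congrArg (fun M => M.map Complex.ofRealHom) hAV
    simpa [W, Matrix.map_mul, Matrix.transpose_map, Matrix.diagonal_map] using this
  have hinv : W.transpose⁻¹ = W := Matrix.inv_eq_right_inv hW2
  have hA : c • A.map Complex.ofReal =
      W.transpose * Matrix.diagonal (fun j => c * (l j : ℂ)) * W.transpose⁻¹ := by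
    have h3 : A.map Complex.ofRealHom =
        W.transpose * Matrix.diagonal (fun j => (l j : ℂ)) * W := by
      rw [← hAW, mul_assoc, hW2, mul_one]
    have h4 : Matrix.diagonal (fun j => c * (l j : ℂ)) =
        c • Matrix.diagonal (fun j => (l j : ℂ)) := by
      rw [← Matrix.diagonal_smul]
      rfl
    rw [hinv, h4, Matrix.mul_smul, Matrix.smul_mul, ← h3]
    rfl
  have hu : IsUnit W.transpose := ⟨⟨W.transpose, W, hW2, hW1⟩, rfl⟩
  rw [hA, Matrix.exp_conj _ _ hu, hinv, Matrix.exp_diagonal, Matrix.mul_apply]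
  refine Finset.sum_congr rfl fun j _ => ?_
  rw [Matrix.mul_diagonal, Pi.exp_def]
  simp only [W, Matrix.transpose_apply, Matrix.map_apply, Complex.ofRealHom_eq_coe,
    Complex.ofReal_mul, Complex.exp_eq_exp_ℂ]
  ring

/-- If the first two eigenvectors are symmetric and antisymmetric under exchanging `a` and `b`,
only their phase difference and the total remaining weight enter the transfer amplitude. -/
theorem norm_exp_apply_le (h1 : V * V.transpose = 1) (h2 : V.transpose * V = 1)
    (hV : ∀ j, A.mulVec (V j) = l j • V j) (t : ℝ) (a b j₁ j₂ : Fin n) (hj : j₁ ≠ j₂)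
    (hs : V j₁ b = V j₁ a) (ha : V j₂ b = -V j₂ a) :
    ‖NormedSpace.exp ((Complex.I * (t : ℂ)) • A.map Complex.ofReal) a b‖ ≤
      ‖((V j₁ a ^ 2 : ℝ) : ℂ) * Complex.exp (Complex.I * t * l j₁) -
        ((V j₂ a ^ 2 : ℝ) : ℂ) * Complex.exp (Complex.I * t * l j₂)‖ +
      (1 - V j₁ a ^ 2 - V j₂ a ^ 2) := by
  have hcol : ∀ c, ∑ j, V j c ^ 2 = 1 := by
    intro c
    have := congrFun (congrFun h2 c) c
    rw [Matrix.mul_apply, Matrix.one_apply_eq] at this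
    rw [← this]
    exact Finset.sum_congr rfl fun j _ => by rw [Matrix.transpose_apply]; ring
  have hsplit : ∀ {M : Type} [AddCommGroup M] (g : Fin n → M),
      ∑ j, g j = g j₁ + (g j₂ + ∑ j ∈ (Finset.univ.erase j₁).erase j₂, g j) := by
    intro M _ g
    rw [Finset.add_sum_erase _ _ (Finset.mem_erase.mpr ⟨hj.symm, Finset.mem_univ _⟩),
      Finset.add_sum_erase _ _ (Finset.mem_univ _)]
  rw [exp_smul_map_ofReal_apply h1 hV, hsplit, ← add_assoc, hs, ha]
  refine (norm_add_le _ _).trans (add_le_add (le_of_eq ?_) ?_)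
  · congr 1
    push_cast
    ring
  · have hrest : ∑ j ∈ (Finset.univ.erase j₁).erase j₂, (V j a ^ 2 + V j b ^ 2) / 2 =
        1 - V j₁ a ^ 2 - V j₂ a ^ 2 := by
      have ea := hcol a
      have eb := hcol b
      rw [hsplit] at ea eb
      rw [hs, ha, neg_sq] at eb
      rw [← Finset.sum_div, Finset.sum_add_distrib]
      linarith
    rw [← hrest]
    refine (norm_sum_le _ _).trans (Finset.sum_le_sum fun j _ => ?_)
    rw [norm_mul, show Complex.I * (t : ℂ) * (l j : ℂ) = ((t * l j : ℝ) : ℂ) * Complex.I by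
      push_cast; ring, Complex.norm_exp_ofReal_mul_I, mul_one, Complex.norm_real, Real.norm_eq_abs,
      abs_mul]
    nlinarith [sq_nonneg (|V j a| - |V j b|), sq_abs (V j a), sq_abs (V j b)]

end OrthogonalEigenvectors

/-! ### Combining two phases -/

theorem norm_sub_mul_exp_sq (a b x y : ℝ) :
    ‖(a : ℂ) * Complex.exp (Complex.I * x) - (b : ℂ) * Complex.exp (Complex.I * y)‖ ^ 2 =
      a ^ 2 + b ^ 2 - 2 * a * b * Real.cos (x - y) := by
  rw [← Complex.normSq_eq_norm_sq, mul_comm Complex.I, mul_comm Complex.I, Complex.exp_mul_I,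
    Complex.exp_mul_I, ← Complex.ofReal_cos, ← Complex.ofReal_cos, ← Complex.ofReal_sin,
    ← Complex.ofReal_sin, Real.cos_sub, Complex.normSq_apply]
  simp only [Complex.sub_re, Complex.mul_re, Complex.ofReal_re, Complex.add_re, Complex.I_re,
    Complex.ofReal_im, Complex.I_im, Complex.sub_im, Complex.mul_im, Complex.add_im]
  linear_combination a ^ 2 * Real.sin_sq_add_cos_sq x + b ^ 2 * Real.sin_sq_add_cos_sq y

/-- Lowering the two weights only increases the bound on the transfer amplitude. -/
theorem norm_sub_mul_exp_add_le {a b a' b' : ℝ} (ha : a' ≤ a) (hb : b' ≤ b) (x y : ℝ) :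
    ‖(a : ℂ) * Complex.exp (Complex.I * x) - (b : ℂ) * Complex.exp (Complex.I * y)‖ +
        (1 - a - b) ≤
      ‖(a' : ℂ) * Complex.exp (Complex.I * x) - (b' : ℂ) * Complex.exp (Complex.I * y)‖ +
        (1 - a' - b') := by
  have hx : ∀ x : ℝ, ‖Complex.exp (Complex.I * x)‖ = 1 := fun x => by
    rw [mul_comm, Complex.norm_exp_ofReal_mul_I]
  have h : (a : ℂ) * Complex.exp (Complex.I * x) - (b : ℂ) * Complex.exp (Complex.I * y) =
      ((a' : ℂ) * Complex.exp (Complex.I * x) - (b' : ℂ) * Complex.exp (Complex.I * y)) +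
      (((a - a' : ℝ) : ℂ) * Complex.exp (Complex.I * x) -
        ((b - b' : ℝ) : ℂ) * Complex.exp (Complex.I * y)) := by
    push_cast
    ring
  have h2 := norm_sub_le (((a - a' : ℝ) : ℂ) * Complex.exp (Complex.I * x))
    (((b - b' : ℝ) : ℂ) * Complex.exp (Complex.I * y))
  rw [norm_mul, norm_mul, hx, hx, mul_one, mul_one, Complex.norm_real, Complex.norm_real,
    Real.norm_of_nonneg (sub_nonneg.mpr ha), Real.norm_of_nonneg (sub_nonneg.mpr hb)] at h2
  rw [h]
  have h3 := norm_add_le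
    ((a' : ℂ) * Complex.exp (Complex.I * x) - (b' : ℂ) * Complex.exp (Complex.I * y))
    (((a - a' : ℝ) : ℂ) * Complex.exp (Complex.I * x) -
        ((b - b' : ℝ) : ℂ) * Complex.exp (Complex.I * y))
  linarith

/-! ### Shape and decay of the two leading eigenvectors -/

/-- Entrywise Rayleigh inequalities `μ F i ^ 2 ≤ F i * (A F) i` for the path with end loops. -/
structure IsLoopPathSubeigenvector (K : ℕ) (w μ : ℝ) (F : ℕ → ℝ) : Prop where
  left : μ * F 0 * F 0 ≤ F 0 * (w * F 0 + F 1)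
  mid : ∀ i < K, μ * F (i + 1) * F (i + 1) ≤ F (i + 1) * (F i + F (i + 2))
  right : μ * F (K + 1) * F (K + 1) ≤ F (K + 1) * (F K + w * F (K + 1))

theorem IsLoopPathSubeigenvector.mulVec_le {K : ℕ} {w μ : ℝ} {F : ℕ → ℝ}
    (h : IsLoopPathSubeigenvector K w μ F) (i : Fin (K + 2)) :
    μ * F i * F i ≤ F i * (loopPathMatrix (K + 2) w).mulVec (fun j => F j) i := by
  obtain ⟨i, hi⟩ := i
  rcases i with _ | i
  · exact (h.left).trans_eq (congrArg _ (loopPathMatrix_mulVec_left K w F).symm)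
  · rcases Nat.lt_or_ge i K with hK | hK
    · exact (h.mid i hK).trans_eq (congrArg _ (loopPathMatrix_mulVec_mid K w F i hK).symm)
    · obtain rfl : i = K := by omega
      exact (h.right).trans_eq (congrArg _ (loopPathMatrix_mulVec_right i w F).symm)

namespace IsLoopPathEigenvector

variable {K : ℕ} {w μ : ℝ} {G : ℕ → ℝ}

/-- The Perron–Frobenius step: absolute values leave the diagonal terms alone and can only increase
the products of neighbours. -/
theorem abs_subeigenvector (hw : 0 ≤ w) (h : IsLoopPathEigenvector K w μ G) :
    IsLoopPathSubeigenvector K w μ (fun i => |G i|) := by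
  have habs : ∀ a b : ℝ, a * b ≤ |a| * |b| := fun a b => by
    rw [← abs_mul]
    exact le_abs_self _
  refine ⟨?_, fun i hi => ?_, ?_⟩
  · have h1 : μ * |G 0| * |G 0| = G 0 * (μ * G 0) := by
      rw [mul_assoc, abs_mul_abs_self]
      ring
    rw [h1, ← h.left]
    nlinarith [habs (G 0) (G 1), abs_mul_abs_self (G 0)]
  · have h1 : μ * |G (i + 1)| * |G (i + 1)| = G (i + 1) * (μ * G (i + 1)) := by
      rw [mul_assoc, abs_mul_abs_self]
      ring
    simp only [h1, ← h.mid i hi]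
    linarith [habs (G (i + 1)) (G i), habs (G (i + 1)) (G (i + 2))]
  · have h1 : μ * |G (K + 1)| * |G (K + 1)| = G (K + 1) * (μ * G (K + 1)) := by
      rw [mul_assoc, abs_mul_abs_self]
      ring
    rw [h1, ← h.right]
    nlinarith [habs (G (K + 1)) (G K), abs_mul_abs_self (G (K + 1))]

/-- A bound on consecutive ratios propagates: if `w G (i+1) ≤ G i`, then `G (i+2) = μ G (i+1) - G i`
is at most `(w + 1/w - w) G (i+1)`. The left loop starts the induction. -/
theorem mul_succ_le (hw : 1 < w) (h : IsLoopPathEigenvector K w μ G) (hμ : μ ≤ w + 1 / w) {m : ℕ}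
    (hm : m ≤ K) (hG : ∀ i ≤ m, 0 ≤ G i) : ∀ i ≤ m, w * G (i + 1) ≤ G i := by
  have h0 : 0 < w := by linarith
  have h1 : w * (1 / w) = 1 := mul_one_div_cancel h0.ne'
  intro i
  induction i with
  | zero =>
    intro _
    have h2 : G 1 ≤ 1 / w * G 0 := by nlinarith [h.left, hG 0 (Nat.zero_le _)]
    calc w * G 1 ≤ w * (1 / w * G 0) := by gcongr
      _ = G 0 := by rw [← mul_assoc, h1, one_mul]
  | succ i ih =>
    intro hi
    have h2 : G (i + 2) ≤ 1 / w * G (i + 1) := by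
      nlinarith [h.mid i (by omega), hG (i + 1) hi, ih (by omega)]
    calc w * G (i + 2) ≤ w * (1 / w * G (i + 1)) := by gcongr
      _ = G (i + 1) := by rw [← mul_assoc, h1, one_mul]

theorem le_inv_pow (hw : 1 < w) (h : IsLoopPathEigenvector K w μ G) (hμ : μ ≤ w + 1 / w)
    (h0 : G 0 = 1) {m : ℕ} (hm : m ≤ K) (hG : ∀ i ≤ m, 0 ≤ G i) :
    ∀ i ≤ m + 1, G i ≤ (w⁻¹) ^ i := by
  have hw0 : 0 < w := by linarith
  intro i
  induction i with
  | zero => simp [h0]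
  | succ i ih =>
    intro hi
    have h2 := h.mul_succ_le hw hμ hm hG i (by omega)
    have h3 : G (i + 1) ≤ w⁻¹ * G i := by
      rw [inv_mul_eq_div, le_div_iff₀ hw0]
      linarith
    calc G (i + 1) ≤ w⁻¹ * G i := h3
      _ ≤ w⁻¹ * (w⁻¹) ^ i := by gcongr; exact ih (by omega)
      _ = (w⁻¹) ^ (i + 1) := by ring

/-- The mirror image of `mul_succ_le`: ratios stay at least `1/w`, so no sign change occurs. This
excludes antisymmetric vectors for such `μ`. -/
theorem pos_of_le (hw : 1 < w) (h : IsLoopPathEigenvector K w μ G) (hμ : w + 1 / w ≤ μ)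
    (h0 : 0 < G 0) : ∀ i ≤ K, 0 < G (i + 1) ∧ G i ≤ w * G (i + 1) := by
  have hw0 : 0 < w := by linarith
  have h1 : w * (1 / w) = 1 := mul_one_div_cancel hw0.ne'
  have step : ∀ a b : ℝ, 0 < a → 1 / w * a ≤ b → 0 < b ∧ a ≤ w * b := by
    intro a b ha hb
    refine ⟨lt_of_lt_of_le (by positivity) hb, ?_⟩
    calc a = w * (1 / w * a) := by rw [← mul_assoc, h1, one_mul]
      _ ≤ w * b := by gcongr
  intro i
  induction i with
  | zero =>
    intro _
    exact step _ _ h0 (by nlinarith [h.left])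
  | succ i ih =>
    intro hi
    obtain ⟨h2, h3⟩ := ih (by omega)
    exact step _ (G (i + 2)) h2 (by nlinarith [h.mid i (by omega)])

/-- The eigenvector of an eigenvalue whose Rayleigh maximizers are all eigenvectors is nonnegative
and symmetric, and its eigenvalue exceeds `w + 1 / w`. -/
theorem top (hw : 1 < w) (h : IsLoopPathEigenvector K w μ G) (h0 : G 0 = 1)
    (H : ∀ f, IsLoopPathSubeigenvector K w μ f → IsLoopPathEigenvector K w μ f) :
    (∀ i ≤ K + 1, 0 ≤ G i) ∧ G (K + 1) = 1 ∧ w + 1 / w ≤ μ := by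
  have h1 := eq_of_zero_eq h (H _ (h.abs_subeigenvector (by linarith))) (by simp [h0])
  have hnn : ∀ i ≤ K + 1, 0 ≤ G i := fun i hi => by
    rw [h1 i hi]
    exact abs_nonneg _
  have hlast : G (K + 1) = 1 := by
    rcases h.flip_eq (by simp [h0]) with h2 | h2
    · simpa [h0] using h2 0 (Nat.zero_le _)
    · have := h2 0 (Nat.zero_le _)
      rw [Nat.sub_zero, h0] at this
      linarith [hnn (K + 1) le_rfl]
  refine ⟨hnn, hlast, ?_⟩
  by_contra hμ
  have h3 := h.le_inv_pow hw (not_le.mp hμ).le h0 le_rfl (fun i hi => hnn i (by omega)) (K + 1)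
    le_rfl
  have h4 : (w⁻¹) ^ (K + 1) < 1 :=
    pow_lt_one₀ (by positivity) (inv_lt_one_of_one_lt₀ hw) (Nat.succ_ne_zero K)
  linarith

/-- If the left half of `G` is positive, `flip_eq` leaves only antisymmetry, as symmetry would
contradict `hneg`. Otherwise `G` is cut off at its first nonpositive entry and continued
antisymmetrically; the result is a Rayleigh maximizer among antisymmetric vectors, hence an
eigenvector, hence `G` itself. -/
theorem second_antisymm (h : IsLoopPathEigenvector K w μ G) (h0 : G 0 = 1)
    (H : ∀ f, (∀ i ≤ K + 1, f (K + 1 - i) = -f i) → IsLoopPathSubeigenvector K w μ f →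
      IsLoopPathEigenvector K w μ f)
    (hneg : ¬ ∀ i ≤ K + 1, 0 ≤ G i) :
    (∀ i ≤ K + 1, G (K + 1 - i) = -G i) ∧ ∀ i, 2 * i ≤ K + 1 → 0 ≤ G i := by
  by_cases hp : ∀ i, 2 * i ≤ K + 1 → 0 < G i
  · refine ⟨?_, fun i hi => (hp i hi).le⟩
    rcases h.flip_eq (by simp [h0]) with h2 | h2
    · refine absurd (fun i hi => ?_) hneg
      by_cases hi2 : 2 * i ≤ K + 1
      · exact (hp i hi2).le
      · rw [← h2 i hi]
        exact (hp (K + 1 - i) (by omega)).le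
    · exact h2
  · push Not at hp
    classical
    let m := Nat.find hp
    obtain ⟨hm1, hm2⟩ : 2 * m ≤ K + 1 ∧ G m ≤ 0 := Nat.find_spec hp
    have hm3 : ∀ i < m, 0 < G i := by
      intro i hi
      have := Nat.find_min hp hi
      push Not at this
      exact this (by omega)
    have hm0 : 0 < m := by
      rcases Nat.eq_zero_or_pos m with h2 | h2
      · rw [h2, h0] at hm2
        linarith
      · exact h2
    -- Since `2 * m ≤ K + 1`, the two nonzero pieces do not overlap. Replacing `G m ≤ 0` by a value
    -- at least as large preserves the Rayleigh inequalities.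
    let f : ℕ → ℝ := fun i => if i < m then G i else if K + 1 - i < m then -G (K + 1 - i) else 0
    have f1 : ∀ i < m, f i = G i := fun i hi => by simp [f, hi]
    have f2 : ∀ i, m ≤ i → m ≤ K + 1 - i → f i = 0 := fun i hi hi' => by
      simp [f, not_lt.mpr hi, not_lt.mpr hi']
    have f3 : ∀ i ≤ K + 1, f (K + 1 - i) = -f i := by
      intro i hi
      have e : K + 1 - (K + 1 - i) = i := by omega
      simp only [f, e]
      split_ifs <;> first | (exfalso; omega) | simp
    have f4 : ∀ i < m, G (i + 1) ≤ f (i + 1) := by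
      intro i hi
      rcases Nat.lt_or_ge (i + 1) m with h2 | h2
      · exact (f1 _ h2).ge
      · obtain h3 : i + 1 = m := by omega
        rw [f2 (i + 1) h2 (by omega), h3]
        exact hm2
    have hsub : IsLoopPathSubeigenvector K w μ f := by
      have hleft : μ * f 0 * f 0 ≤ f 0 * (w * f 0 + f 1) := by
        have := f4 0 hm0
        rw [f1 0 hm0, h0]
        linarith [h.left, h0 ▸ h.left]
      have hmid : ∀ i, i + 1 < m → μ * f (i + 1) * f (i + 1) ≤ f (i + 1) * (f i + f (i + 2)) := by
        intro i hi
        rw [f1 i (by omega), f1 (i + 1) hi, mul_comm (μ * _), ← h.mid i (by omega)]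
        exact mul_le_mul_of_nonneg_left (by linarith [f4 (i + 1) hi]) (hm3 _ hi).le
      refine ⟨hleft, fun i hi => ?_, ?_⟩
      · rcases Nat.lt_or_ge (i + 1) m with h2 | h2
        · exact hmid i h2
        · rcases Nat.lt_or_ge (K + 1 - (i + 1)) m with h3 | h3
          · have h4 := hmid (K + 1 - (i + 2)) (by omega)
            have e1 : K + 1 - (i + 2) + 1 = K + 1 - (i + 1) := by omega
            have e2 : K + 1 - (i + 2) + 2 = K + 1 - i := by omega
            rw [e1, e2, f3 _ (by omega), f3 _ (by omega), f3 _ (by omega)] at h4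
            linarith
          · rw [f2 _ h2 h3]
            simp
      · have e1 := f3 0 (by omega)
        have e2 := f3 1 (by omega)
        simp only [Nat.sub_zero, Nat.add_sub_cancel] at e1 e2
        rw [e1, e2]
        linarith
    have hf := eq_of_zero_eq h (H f f3 hsub) (f1 0 hm0).symm
    refine ⟨fun i hi => ?_, fun i hi => ?_⟩
    · rw [hf i hi, hf (K + 1 - i) (by omega), f3 i hi]
    · rcases Nat.lt_or_ge i m with h2 | h2
      · exact (hm3 i h2).le
      · rw [hf i (by omega), f2 i h2 (by omega)]

/-- Antisymmetry forces `μ ≤ w + 1/w`, so squares decay like `w ^ (-2 i)` from either end; the bound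
is twice the full geometric series. -/
theorem second_sum_le (hw : 1 < w) (h : IsLoopPathEigenvector K w μ G) (h0 : G 0 = 1)
    (ha : ∀ i ≤ K + 1, G (K + 1 - i) = -G i) (hp : ∀ i, 2 * i ≤ K + 1 → 0 ≤ G i) :
    ∑ i ∈ Finset.range (K + 2), G i ^ 2 ≤ 2 * w ^ 2 / (w ^ 2 - 1) := by
  have hw0 : 0 < w := by linarith
  have hμ : μ ≤ w + 1 / w := by
    by_contra hμ
    have h1 := (h.pos_of_le hw (not_le.mp hμ).le (by simp [h0]) K le_rfl).1
    have h2 := ha 0 (by omega)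
    rw [Nat.sub_zero, h0] at h2
    linarith
  set q : ℝ := (w⁻¹) ^ 2 with hq
  have hq0 : 0 ≤ q := by positivity
  have hq1 : q < 1 := pow_lt_one₀ (by positivity) (inv_lt_one_of_one_lt₀ hw) two_ne_zero
  have hhalf : ∀ i, 2 * i ≤ K + 1 → G i ^ 2 ≤ q ^ i := by
    intro i hi
    have h1 := h.le_inv_pow hw hμ h0 (m := (K + 1) / 2) (by omega)
      (fun j hj => hp j (by omega)) i (by omega)
    calc G i ^ 2 ≤ ((w⁻¹) ^ i) ^ 2 := pow_le_pow_left₀ (hp i hi) h1 2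
      _ = q ^ i := by rw [hq, ← pow_mul, ← pow_mul, mul_comm]
  have hterm : ∀ i ∈ Finset.range (K + 2), G i ^ 2 ≤ q ^ i + q ^ (K + 2 - 1 - i) := by
    intro i hi
    rw [Finset.mem_range] at hi
    have hn1 : 0 ≤ q ^ i := by positivity
    have hn2 : 0 ≤ q ^ (K + 2 - 1 - i) := by positivity
    by_cases hi2 : 2 * i ≤ K + 1
    · linarith [hhalf i hi2]
    · have h1 := hhalf (K + 1 - i) (by omega)
      rw [ha i (by omega), neg_sq] at h1
      have e : K + 2 - 1 - i = K + 1 - i := by omega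
      rw [e] at hn2 ⊢
      linarith
  refine (Finset.sum_le_sum hterm).trans ?_
  rw [Finset.sum_add_distrib, Finset.sum_range_reflect (fun i => q ^ i)]
  have hgeom : ∑ i ∈ Finset.range (K + 2), q ^ i ≤ (1 - q)⁻¹ := by
    rw [← tsum_geometric_of_lt_one hq0 hq1]
    exact (summable_geometric_of_lt_one hq0 hq1).sum_le_tsum _ fun i _ => by positivity
  have he : 2 * w ^ 2 / (w ^ 2 - 1) = 2 * (1 - q)⁻¹ := by
    have h1 : w ^ 2 - 1 ≠ 0 := by nlinarith
    have h2 : 1 - q ≠ 0 := by linarith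
    rw [div_eq_iff h1, mul_assoc, eq_comm, inv_mul_eq_div, mul_div_assoc', div_eq_iff h2, hq]
    field_simp
  rw [he]
  linarith

end IsLoopPathEigenvector

/-! ### Comparison bound for the top eigenvector -/

/-- Minimum principle: at an interior minimum, `2 d ≤ D d` with `D > 2` gives `d ≥ 0`. -/
theorem nonneg_of_superharmonic {K : ℕ} {D : ℝ} (hD : 2 < D) {d : ℕ → ℝ} (h0 : d 0 = 0)
    (h1 : d (K + 1) = 0) (hd : ∀ i < K, d i + d (i + 2) ≤ D * d (i + 1)) :
    ∀ i ≤ K + 1, 0 ≤ d i := by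
  obtain ⟨k, hk, hmin⟩ := Finset.exists_min_image (Finset.range (K + 2)) d ⟨0, by simp⟩
  simp only [Finset.mem_range] at hk hmin
  suffices 0 ≤ d k from fun i hi => this.trans (hmin i (by omega))
  rcases k with _ | k
  · exact h0.ge
  · rcases Nat.lt_or_ge k K with h2 | h2
    · have := hd k h2
      have := hmin k (by omega)
      have := hmin (k + 2) (by omega)
      by_contra hneg
      nlinarith
    · obtain rfl : k = K := by omega
      exact h1.ge

/-- After division by `w ^ 2 - 1` this is AM–GM for the terms `w ^ (2 j)`, `j < M`. -/
theorem mul_sq_sub_one_le_pow {w : ℝ} (hw : 1 < w) (M : ℕ) :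
    M * (w ^ 2 - 1) * w ^ M ≤ w * (w ^ (2 * M) - 1) := by
  induction M with
  | zero => simp
  | succ M ih =>
    have h1 : 1 ≤ w ^ M := one_le_pow₀ hw.le
    have h2 : 1 ≤ w * w ^ M := by nlinarith
    have e : w ^ (2 * M) = w ^ M * w ^ M := by rw [two_mul, pow_add]
    have e2 : w ^ (2 * (M + 1)) = w ^ 2 * (w ^ M * w ^ M) := by ring
    rw [e] at ih
    rw [e2, pow_succ w M]
    push_cast
    have h3 : 0 ≤ w * (w - 1) * ((w * w ^ M - 1) * (w ^ M - 1)) :=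
      mul_nonneg (by nlinarith) (mul_nonneg (by linarith) (by linarith))
    nlinarith [mul_le_mul_of_nonneg_left ih (show 0 ≤ w by linarith)]

theorem mul_sq_sub_one_le_pow_succ {w : ℝ} (hw : 1 < w) (M : ℕ) :
    M * (w ^ 2 - 1) ≤ w ^ (M + 1) := by
  have h := mul_sq_sub_one_le_pow hw M
  have h1 : 0 < w ^ M := by positivity
  refine le_of_mul_le_mul_right (h.trans ?_) h1
  have e : w ^ (M + 1) * w ^ M = w * w ^ (2 * M) := by ring
  rw [e]
  nlinarith

theorem sq_mul_sq_sub_one_le {w : ℝ} (hw : 1 < w) {N : ℕ} (hN : 2 ≤ N) :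
    ((N : ℝ) * (w ^ 2 - 1)) ^ 2 ≤ 8 * w ^ 2 * w ^ N := by
  have hq : 0 ≤ w ^ 2 - 1 := by nlinarith
  obtain ⟨M, hM⟩ := Nat.even_or_odd' N
  have hb := mul_sq_sub_one_le_pow_succ hw M
  have hb2 : ((M : ℝ) * (w ^ 2 - 1)) ^ 2 ≤ (w ^ (M + 1)) ^ 2 :=
    pow_le_pow_left₀ (by positivity) hb 2
  have e : (w ^ (M + 1)) ^ 2 = w ^ 2 * w ^ (2 * M) := by ring
  rw [e] at hb2
  have hp : 0 < w ^ 2 * w ^ (2 * M) := by positivity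
  rcases hM with rfl | rfl
  · push_cast
    nlinarith
  · have hp2 : w ^ 2 * w ^ (2 * M) ≤ w ^ 2 * w ^ (2 * M + 1) := by
      gcongr
      · exact hw.le
      · omega
    -- The estimate `(2M + 1)² ≤ 8M²` starts at `M = 2`; the case `N = 3` is checked as a polynomial
    -- in `w - 1`.
    rcases Nat.lt_or_ge M 2 with h2 | h2
    · obtain rfl : M = 1 := by omega
      obtain ⟨u, hu, rfl⟩ : ∃ u : ℝ, 0 < u ∧ w = 1 + u := ⟨w - 1, by linarith, by ring⟩
      have : 0 ≤ 8 + 40 * u + 44 * u ^ 2 + 44 * u ^ 3 + 31 * u ^ 4 + 8 * u ^ 5 := by positivity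
      norm_num
      nlinarith
    · have hM2 : (2 : ℝ) ≤ M := by exact_mod_cast h2
      have h3 : (2 * (M : ℝ) + 1) ^ 2 ≤ 8 * (M : ℝ) ^ 2 := by nlinarith
      push_cast
      calc ((2 * (M : ℝ) + 1) * (w ^ 2 - 1)) ^ 2
          = (2 * (M : ℝ) + 1) ^ 2 * (w ^ 2 - 1) ^ 2 := by ring
        _ ≤ 8 * (M : ℝ) ^ 2 * (w ^ 2 - 1) ^ 2 := by gcongr
        _ = 8 * ((M : ℝ) * (w ^ 2 - 1)) ^ 2 := by ring
        _ ≤ 8 * (w ^ 2 * w ^ (2 * M + 1)) := by linarith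
        _ = 8 * w ^ 2 * w ^ (2 * M + 1) := by ring

/-- The left side is the sum of `(w ^ (N - i) + w ^ i) ^ 2` over `0 ≤ i ≤ N`. The term with 16
absorbs the cross terms `2 (N + 1) w ^ N`. -/
theorem two_mul_geom_add_le {w : ℝ} (hw : 1 < w) {N : ℕ} (hN : 1 ≤ N) :
    2 * ((w ^ 2) ^ (N + 1) - 1) / (w ^ 2 - 1) + 2 * (N + 1) * w ^ N ≤
      (w ^ N + 1) ^ 2 *
        (2 * w ^ 2 / (w ^ 2 - 1) + 16 * w ^ 2 / (N * (w ^ 2 - 1) ^ 2)) := by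
  have hq : 0 < w ^ 2 - 1 := by nlinarith
  have hN0 : (0 : ℝ) < N := by exact_mod_cast hN
  have e : (w ^ 2) ^ (N + 1) = w ^ 2 * (w ^ N) ^ 2 := by ring
  rw [e]
  have hp : 1 ≤ w ^ N := one_le_pow₀ hw.le
  -- What remains after clearing denominators, up to a positive factor and the nonnegative remainder
  -- `hw2`.
  have key : ((N : ℝ) * (w ^ 2 - 1)) ^ 2 * w ^ N ≤
      N * (w ^ 2 - 1) * ((w ^ 2 + 1) * w ^ N) + 8 * w ^ 2 * (w ^ N + 1) ^ 2 := by
    rcases Nat.lt_or_ge N 2 with h2 | h2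
    · obtain rfl : N = 1 := by omega
      norm_num
      have : 0 ≤ w * (w ^ 2 - 1) := by positivity
      nlinarith [sq_nonneg (w * (w + 1))]
    · have h3 := mul_le_mul_of_nonneg_right (sq_mul_sq_sub_one_le hw h2)
        (zero_le_one.trans hp)
      have h4 : 0 ≤ N * (w ^ 2 - 1) * ((w ^ 2 + 1) * w ^ N) := by positivity
      have h5 : 0 ≤ w ^ 2 * w ^ N := by positivity
      nlinarith [sq_nonneg w]
  rw [div_add' _ _ _ hq.ne', div_add_div _ _ hq.ne' (by positivity), mul_div_assoc',
    div_le_div_iff₀ hq (by positivity)]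
  generalize w ^ N = p at *
  obtain ⟨q, hq2⟩ : ∃ q, w ^ 2 = q + 1 := ⟨w ^ 2 - 1, by ring⟩
  simp only [hq2, add_sub_cancel_right] at *
  have hw2 : 0 ≤ 2 * q ^ 2 * (N * q * (q + 2)) := by positivity
  nlinarith [mul_le_mul_of_nonneg_left key (show 0 ≤ 2 * q ^ 2 by positivity)]

/-- With `N = K + 1`, the sequence `(w ^ (N - i) + w ^ i) / (w ^ N + 1)` solves the recurrence for
`w + 1/w` with the same end values; as `μ` is at least that large, the minimum principle puts `G`
below it. -/
theorem IsLoopPathEigenvector.top_sum_le {K : ℕ} {w μ : ℝ} {G : ℕ → ℝ} (hw : 1 < w)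
    (h : IsLoopPathEigenvector K w μ G) (h0 : G 0 = 1) (h1 : G (K + 1) = 1)
    (hnn : ∀ i ≤ K + 1, 0 ≤ G i) (hμ : w + 1 / w ≤ μ) :
    ∑ i ∈ Finset.range (K + 2), G i ^ 2 ≤
      2 * w ^ 2 / (w ^ 2 - 1) + 16 * w ^ 2 / (((K + 1 : ℕ) : ℝ) * (w ^ 2 - 1) ^ 2) := by
  have hw0 : 0 < w := by linarith
  have hD : 2 < w + 1 / w := by
    have : w + 1 / w - 2 = (w - 1) ^ 2 / w := by
      field_simp
      ring
    have : 0 < (w - 1) ^ 2 / w := div_pos (pow_pos (by linarith) 2) hw0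
    linarith
  set c : ℝ := w ^ (K + 1) + 1 with hc
  have hc0 : 0 < c := by positivity
  have hcmp : ∀ i ≤ K + 1, 0 ≤ w ^ (K + 1 - i) + w ^ i - c * G i := by
    refine nonneg_of_superharmonic hD ?_ ?_ fun i hi => ?_
    · simp [h0, hc]
    · simp only [h1, hc, Nat.sub_self]
      ring
    · have h2 := h.mid i hi
      obtain ⟨j, rfl⟩ : ∃ j, K = i + 1 + j := ⟨K - (i + 1), by omega⟩
      have e1 : i + 1 + j + 1 - i = j + 2 := by omega
      have e2 : i + 1 + j + 1 - (i + 2) = j := by omega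
      have e3 : i + 1 + j + 1 - (i + 1) = j + 1 := by omega
      rw [e1, e2, e3]
      have h3 : (w + 1 / w) * (w ^ (j + 1) + w ^ (i + 1)) =
          w ^ (j + 2) + w ^ i + (w ^ j + w ^ (i + 2)) := by
        field_simp
        ring
      have h4 : (w + 1 / w) * (c * G (i + 1)) ≤ c * (G i + G (i + 2)) := by
        rw [h2]
        have := mul_le_mul_of_nonneg_right hμ (mul_nonneg hc0.le (hnn (i + 1) (by omega)))
        linarith
      linarith
  have hsum : c ^ 2 * ∑ i ∈ Finset.range (K + 2), G i ^ 2 ≤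
      ∑ i ∈ Finset.range (K + 2),
        ((w ^ 2) ^ (K + 2 - 1 - i) + (w ^ 2) ^ i + 2 * w ^ (K + 1)) := by
    rw [Finset.mul_sum]
    refine Finset.sum_le_sum fun i hi => ?_
    rw [Finset.mem_range] at hi
    have h2 : (c * G i) ^ 2 ≤ (w ^ (K + 1 - i) + w ^ i) ^ 2 :=
      pow_le_pow_left₀ (mul_nonneg hc0.le (hnn i (by omega)))
        (by linarith [hcmp i (by omega)]) 2
    have e1 : w ^ (K + 1) = w ^ (K + 1 - i) * w ^ i := by
      rw [← pow_add]
      congr 1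
      omega
    have e2 : K + 2 - 1 - i = K + 1 - i := by omega
    rw [e1, e2, ← pow_mul, ← pow_mul, mul_comm 2, mul_comm 2, pow_mul, pow_mul]
    linarith
  rw [Finset.sum_add_distrib, Finset.sum_add_distrib,
    Finset.sum_range_reflect (fun i => (w ^ 2) ^ i),
    geom_sum_eq (by nlinarith), Finset.sum_const, Finset.card_range, nsmul_eq_mul] at hsum
  have hfin := two_mul_geom_add_le hw (N := K + 1) (by omega)
  rw [← hc] at hfin
  refine le_of_mul_le_mul_left (hsum.trans (le_trans (le_of_eq ?_) hfin)) (pow_pos hc0 2)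
  push_cast
  ring

/-! ### The function `b` -/

/-- At `x = w + 1/w` the root is `w - 1/w`, so `b` is exactly the reciprocal of the bound in
`top_sum_le`. -/
theorem loopPathB_add_inv {K : ℕ} {w : ℝ} (hw : 1 < w) :
    loopPathB (K + 2) (w + 1 / w) =
      (2 * w ^ 2 / (w ^ 2 - 1) + 16 * w ^ 2 / (((K + 1 : ℕ) : ℝ) * (w ^ 2 - 1) ^ 2))⁻¹ := by
  have hw0 : 0 < w := by linarith
  have h2 : 0 < w - 1 / w := by
    have : 1 / w < 1 := by rw [div_lt_one hw0]; exact hw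
    linarith
  have h3 : (w + 1 / w) ^ 2 - 4 = (w - 1 / w) ^ 2 := by
    field_simp
    ring
  have hq : w ^ 2 - 1 ≠ 0 := by nlinarith
  have h4 : w - 1 / w = (w ^ 2 - 1) / w := by field_simp
  have hK : (((K + 2 : ℕ) : ℝ) - 1) = ((K + 1 : ℕ) : ℝ) := by push_cast; ring
  have hK0 : ((K + 1 : ℕ) : ℝ) ≠ 0 := by positivity
  rw [loopPathB, h3, Real.sqrt_sq h2.le, hK]
  congr 2
  · rw [h4]
    field_simp
    ring
  · rw [h4]
    field_simp

theorem loopPathB_mono {n : ℕ} (hn : 2 ≤ n) {x y : ℝ} (hx : 2 < x) (hxy : x ≤ y) :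
    loopPathB n x ≤ loopPathB n y := by
  have hn1 : (0 : ℝ) < n - 1 := by
    have : (2 : ℝ) ≤ n := by exact_mod_cast hn
    linarith
  have hx4 : 0 < x ^ 2 - 4 := by nlinarith
  have hxy2 : x ^ 2 ≤ y ^ 2 := pow_le_pow_left₀ (by linarith) hxy 2
  have hy4 : 0 < y ^ 2 - 4 := by linarith
  have hsx := Real.sqrt_pos.mpr hx4
  have hsy := Real.sqrt_pos.mpr hy4
  have hy0 : 0 < y := by linarith
  rw [loopPathB, loopPathB]
  refine inv_anti₀ (by positivity) (add_le_add ?_ ?_)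
  · rw [add_div, add_div, div_self hsx.ne', div_self hsy.ne', add_le_add_iff_right,
      div_le_div_iff₀ hsy hsx]
    refine abs_le_of_sq_le_sq' ?_ (by positivity) |>.2
    rw [mul_pow, mul_pow, Real.sq_sqrt hx4.le, Real.sq_sqrt hy4.le]
    nlinarith
  · gcongr

theorem loopPathB_pos {n : ℕ} (hn : 2 ≤ n) {x : ℝ} (hx : 2 < x) : 0 < loopPathB n x := by
  have hn1 : (0 : ℝ) < n - 1 := by
    have : (2 : ℝ) ≤ n := by exact_mod_cast hn
    linarith
  have hx4 : 0 < x ^ 2 - 4 := by nlinarith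
  have := Real.sqrt_pos.mpr hx4
  rw [loopPathB]
  positivity

theorem loopPathB_le_half {n : ℕ} (hn : 2 ≤ n) {x : ℝ} (hx : 2 < x) :
    loopPathB n x ≤ 1 / 2 := by
  have hn1 : (0 : ℝ) < n - 1 := by
    have : (2 : ℝ) ≤ n := by exact_mod_cast hn
    linarith
  have hx4 : 0 < x ^ 2 - 4 := by nlinarith
  have hs := Real.sqrt_pos.mpr hx4
  have h1 : 0 ≤ 16 / (((n : ℝ) - 1) * (x ^ 2 - 4)) := by positivity
  have h2 : 1 ≤ x / √(x ^ 2 - 4) := by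
    rw [one_le_div hs, Real.sqrt_le_left (by linarith)]
    linarith
  rw [loopPathB, add_div, div_self hs.ne', one_div]
  exact inv_anti₀ two_pos (by linarith)

theorem loopPathTau_nonneg {n : ℕ} {w : ℝ} (hw : 1 < w) : 0 ≤ loopPathTau n w := by
  have h1 : 1 ≤ w ^ (2 * ⌈(n : ℝ) / 2⌉₊) := one_le_pow₀ hw.le
  rw [loopPathTau]
  exact div_nonneg (mul_nonneg (sq_nonneg _) (by linarith))
    (mul_nonneg (by linarith) (by linarith))

theorem loopPathEigenvalue_antitone (n : ℕ) (w : ℝ) : Antitone (loopPathEigenvalue n w) :=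
  fun _ _ h => (loopPathMatrix_isHermitian n w).eigenvalues₀_antitone h

/-! ### The amplitude bound -/

/-- The transfer amplitude between the ends is bounded through the weights `b₁`, `b₂` of the two
leading eigenvectors at an end vertex. -/
theorem norm_loopPathTransition_le (K : ℕ) {w : ℝ} (hw : 1 < w) (t : ℝ) :
    ‖loopPathTransition (K + 2) w t 0 (Fin.last (K + 1))‖ ≤
      ‖((loopPathB (K + 2) (w + 1 / w) : ℝ) : ℂ) *
          Complex.exp (Complex.I * (t * loopPathEigenvalue (K + 2) w 0 : ℝ)) -
        ((loopPathB (K + 2) (w + 1 / w) : ℝ) : ℂ) *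
          Complex.exp (Complex.I * (t * loopPathEigenvalue (K + 2) w 1 : ℝ))‖ +
      (1 - loopPathB (K + 2) (w + 1 / w) - loopPathB (K + 2) (w + 1 / w)) := by
  have hA := loopPathMatrix_isHermitian (K + 2) w
  obtain ⟨V, h1, h2, hV⟩ := exists_orthogonal_eigenvectors _ hA
  set l : Fin (K + 2) → ℝ := loopPathEigenvalue (K + 2) w with hl
  replace hV : ∀ j, (loopPathMatrix (K + 2) w).mulVec (V j) = l j • V j := hV
  have hanti : Antitone l := loopPathEigenvalue_antitone _ _
  have hext : ∀ j, ∃ F : ℕ → ℝ, (fun i : Fin (K + 2) => F i) = V j := fun j =>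
    ⟨fun i => if h : i < K + 2 then V j ⟨i, h⟩ else 0, by ext i; simp⟩
  choose F hF using hext
  have hFi : ∀ j (i : Fin (K + 2)), F j i = V j i := fun j i => congrFun (hF j) i
  have hFeig : ∀ j, IsLoopPathEigenvector K w (l j) (F j) := fun j => by
    rw [isLoopPathEigenvector_iff, hF j, hV j]
    intro i
    rw [hFi]
    rfl
  have horth : ∀ j k, V j ⬝ᵥ V k = if j = k then 1 else 0 := fun j k => by
    rw [← Matrix.one_apply, ← h1]
    rfl
  have hnorm : ∀ j, ∑ i ∈ Finset.range (K + 2), F j i ^ 2 = 1 := fun j => by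
    have := horth j j
    rw [if_pos rfl, ← hF j] at this
    rw [← Fin.sum_univ_eq_sum_range (fun i => F j i ^ 2), ← this]
    exact Finset.sum_congr rfl fun i _ => sq _
  have hF0 : ∀ j, F j 0 ≠ 0 := fun j h0 => by
    have hz := IsLoopPathEigenvector.eq_of_zero_eq (hFeig j) ((hFeig j).smul 0) (by simp [h0])
    have := hnorm j
    rw [Finset.sum_eq_zero fun i hi => ?_] at this
    · exact zero_ne_one this
    · rw [Finset.mem_range] at hi
      rw [hz i (by omega)]
      simp
  -- Scaling to first entry 1 makes the squared end entry of the unit vector the reciprocal of the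
  -- sum of squares of `G j`.
  let G : Fin (K + 2) → ℕ → ℝ := fun j i => (F j 0)⁻¹ * F j i
  have hGeig : ∀ j, IsLoopPathEigenvector K w (l j) (G j) := fun j => (hFeig j).smul _
  have hG0 : ∀ j, G j 0 = 1 := fun j => inv_mul_cancel₀ (hF0 j)
  have hFG : ∀ j i, F j i = F j 0 * G j i := fun j i => by
    simp only [G]
    rw [mul_inv_cancel_left₀ (hF0 j)]
  have hGsum : ∀ j, F j 0 ^ 2 * ∑ i ∈ Finset.range (K + 2), G j i ^ 2 = 1 := fun j => by
    rw [← hnorm j, Finset.mul_sum]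
    exact Finset.sum_congr rfl fun i _ => by rw [hFG j i]; ring
  have hGorth : ∀ f : ℕ → ℝ, ∀ j,
      V j ⬝ᵥ (fun i : Fin (K + 2) => f i) =
        F j 0 * ∑ i ∈ Finset.range (K + 2), G j i * f i := fun f j => by
    rw [← hF j, Finset.mul_sum, ← Fin.sum_univ_eq_sum_range (fun i => F j 0 * (G j i * f i))]
    exact Finset.sum_congr rfl fun i _ => by
      simp only [hFG j i, mul_assoc]
  have hray : ∀ (f : ℕ → ℝ) (μ : ℝ), IsLoopPathSubeigenvector K w μ f →
      (∀ j, l j ≤ μ ∨ V j ⬝ᵥ (fun i : Fin (K + 2) => f i) = 0) →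
      IsLoopPathEigenvector K w μ f := fun f μ hf hμ => by
    rw [isLoopPathEigenvector_iff]
    intro i
    rw [mulVec_eq_smul_of_rayleigh h2 hA hV _ μ hμ hf.mulVec_le]
    rfl
  obtain ⟨hnn, hlast, hμ⟩ := (hGeig 0).top hw (hG0 0) fun f hf =>
    hray f _ hf fun j => Or.inl (hanti (Fin.zero_le j))
  have hsymm : ∀ i ≤ K + 1, G 0 (K + 1 - i) = G 0 i := by
    rcases (hGeig 0).flip_eq (by simp [hG0]) with h | h
    · exact h
    · have := h 0 (Nat.zero_le _)
      rw [Nat.sub_zero, hlast, hG0] at this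
      norm_num at this
  -- Antisymmetric test vectors are orthogonal to the symmetric top eigenvector, so only eigenvalues
  -- up to `λ₂` matter for them.
  obtain ⟨ha, hp⟩ := (hGeig 1).second_antisymm (hG0 1) (fun f hfa hf =>
    hray f _ hf fun j => by
      rcases Fin.eq_zero_or_eq_succ j with rfl | ⟨i, rfl⟩
      · right
        rw [hGorth]
        have hr := Finset.sum_range_reflect (fun i => G 0 i * f i) (K + 2)
        have hr2 : ∑ i ∈ Finset.range (K + 2), G 0 (K + 2 - 1 - i) * f (K + 2 - 1 - i) =
            ∑ i ∈ Finset.range (K + 2), -(G 0 i * f i) := by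
          refine Finset.sum_congr rfl fun i hi => ?_
          rw [Finset.mem_range] at hi
          rw [show K + 2 - 1 - i = K + 1 - i by omega, hsymm i (by omega), hfa i (by omega)]
          ring
        rw [hr2, Finset.sum_neg_distrib] at hr
        rw [show ∑ i ∈ Finset.range (K + 2), G 0 i * f i = 0 by linarith, mul_zero]
      · exact Or.inl (hanti (Fin.one_le_of_ne_zero (Fin.succ_ne_zero i))))
    -- A nonnegative second vector would have inner product at least `1 * 1` with the top one,
    -- against orthogonality.
    (fun hall => by
      have h3 := hGorth (G 1) 0
      have h4 : (fun i : Fin (K + 2) => G 1 i) = (F 1 0)⁻¹ • V 1 := by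
        rw [← hF 1]
        rfl
      rw [h4, dotProduct_smul, horth, if_neg (by simp), smul_zero] at h3
      rcases mul_eq_zero.mp h3.symm with h5 | h5
      · exact hF0 0 h5
      · have h6 : G 0 0 * G 1 0 ≤ ∑ i ∈ Finset.range (K + 2), G 0 i * G 1 i :=
          Finset.single_le_sum (f := fun i => G 0 i * G 1 i) (fun i hi => by
            rw [Finset.mem_range] at hi
            exact mul_nonneg (hnn i (by omega)) (hall i (by omega))) (by simp)
        rw [h5, hG0, hG0] at h6
        norm_num at h6)
  have hs0 := (hGeig 0).top_sum_le hw (hG0 0) hlast hnn hμ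
  have hs1 := (hGeig 1).second_sum_le hw (hG0 1) ha hp
  have hq : 0 < w ^ 2 - 1 := by nlinarith
  have hs1' : ∑ i ∈ Finset.range (K + 2), G 1 i ^ 2 ≤
      2 * w ^ 2 / (w ^ 2 - 1) + 16 * w ^ 2 / (((K + 1 : ℕ) : ℝ) * (w ^ 2 - 1) ^ 2) :=
    hs1.trans (le_add_of_nonneg_right (by positivity))
  have hweight : ∀ j, ∑ i ∈ Finset.range (K + 2), G j i ^ 2 ≤
      2 * w ^ 2 / (w ^ 2 - 1) + 16 * w ^ 2 / (((K + 1 : ℕ) : ℝ) * (w ^ 2 - 1) ^ 2) →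
      loopPathB (K + 2) (w + 1 / w) ≤ V j 0 ^ 2 := fun j hj => by
    have h3 := hGsum j
    have h4 : V j 0 = F j 0 := (hFi j 0).symm
    rw [loopPathB_add_inv hw, h4, inv_le_iff_one_le_mul₀ (by positivity)]
    exact h3.ge.trans (mul_le_mul_of_nonneg_left hj (sq_nonneg _))
  have hb0 := hweight 0 hs0
  have hb1 := hweight 1 hs1'
  have hVs : V 0 (Fin.last (K + 1)) = V 0 0 := by
    have h3 := hFi 0 (Fin.last (K + 1))
    have h4 := hFi 0 0
    rw [← h3, ← h4, Fin.val_last, hFG 0 (K + 1), hlast, mul_one]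
    rfl
  have hVa : V 1 (Fin.last (K + 1)) = -V 1 0 := by
    have h3 := hFi 1 (Fin.last (K + 1))
    have h4 := hFi 1 0
    have h5 := ha 0 (Nat.zero_le _)
    rw [Nat.sub_zero, hG0] at h5
    rw [← h3, ← h4, Fin.val_last, hFG 1 (K + 1), h5, mul_neg_one]
    rfl
  have hmain := norm_exp_apply_le h1 h2 hV t 0 (Fin.last (K + 1)) 0 1 (by simp) hVs hVa
  have hcast : ∀ j, Complex.I * (t : ℂ) * (l j : ℂ) = Complex.I * ((t * l j : ℝ) : ℂ) :=
    fun j => by push_cast; ring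
  rw [hcast, hcast] at hmain
  exact hmain.trans (norm_sub_mul_exp_add_le hb0 hb1 _ _)

/-! ### From the amplitude to the phase -/

section PhaseBounds

variable {b₁ b₂ γ α : ℝ}

theorem cos_le_of_amplitude_le (h1 : 0 < b₁) (h2 : 0 < b₂) (hγ : 1 - b₁ - b₂ ≤ γ) {r : ℝ}
    (hr : r ^ 2 = b₁ ^ 2 + b₂ ^ 2 - 2 * b₁ * b₂ * Real.cos α) (hle : γ ≤ r + (1 - b₁ - b₂)) :
    Real.cos α ≤ -1 + (1 - γ) * ((b₁ + b₂) / (b₁ * b₂)) - (1 - γ) ^ 2 / (2 * b₁ * b₂) := by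
  have h3 : (γ - (1 - b₁ - b₂)) ^ 2 ≤ r ^ 2 :=
    pow_le_pow_left₀ (by linarith) (by linarith) 2
  rw [hr] at h3
  have h4 : -1 + (1 - γ) * ((b₁ + b₂) / (b₁ * b₂)) - (1 - γ) ^ 2 / (2 * b₁ * b₂) =
      (-2 * b₁ * b₂ + 2 * (1 - γ) * (b₁ + b₂) - (1 - γ) ^ 2) / (2 * b₁ * b₂) := by
    field_simp
  rw [h4, le_div_iff₀ (by positivity)]
  linarith

theorem exists_eq_odd_mul_pi_add (hα : 0 ≤ α) :
    ∃ (k : ℕ) (z : ℝ), |z| ≤ Real.pi ∧ α = (2 * k + 1) * Real.pi + z := by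
  have hpi := Real.pi_pos
  have h1 := Nat.floor_le (div_nonneg hα (mul_pos two_pos hpi).le)
  have h2 := Nat.lt_floor_add_one (α / (2 * Real.pi))
  rw [le_div_iff₀ (by positivity)] at h1
  rw [div_lt_iff₀ (by positivity)] at h2
  refine ⟨⌊α / (2 * Real.pi)⌋₊, α - (2 * ⌊α / (2 * Real.pi)⌋₊ + 1) * Real.pi, ?_, by ring⟩
  rw [abs_le]
  constructor <;> linarith

theorem abs_le_arccos_of_cos_le {c z : ℝ} {k : ℕ} (hz : |z| ≤ Real.pi)
    (hα : α = (2 * k + 1) * Real.pi + z) (hc : Real.cos α ≤ -c) : |z| ≤ Real.arccos c := by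
  have h1 : Real.cos α = -Real.cos z := by
    rw [hα, show (2 * (k : ℝ) + 1) * Real.pi + z = z + Real.pi + k * (2 * Real.pi) by ring,
      Real.cos_add_nat_mul_two_pi, Real.cos_add_pi]
  rw [← Real.arccos_cos (abs_nonneg z) hz, Real.cos_abs]
  exact Real.arccos_le_arccos (by linarith)

/-- At `γ = 1` the argument is 1 and `arccos 1 = 0`; the rest is continuity. -/
theorem exists_arccos_lt {C D ε m : ℝ} (hε : 0 < ε) (hm : m < 1) :
    ∃ γ₀ : ℝ, 0 ≤ γ₀ ∧ γ₀ < 1 ∧ m ≤ γ₀ ∧ ∀ γ, γ₀ ≤ γ → γ ≤ 1 →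
      Real.arccos (1 - (1 - γ) * C + (1 - γ) ^ 2 / D) < ε := by
  have hcont : Continuous fun γ : ℝ => Real.arccos (1 - (1 - γ) * C + (1 - γ) ^ 2 / D) :=
    Real.continuous_arccos.comp (by fun_prop)
  obtain ⟨δ, hδ, h⟩ := Metric.continuousAt_iff.mp (hcont.continuousAt (x := 1)) ε hε
  refine ⟨max (max 0 m) (1 - δ / 2), le_max_of_le_left (le_max_left _ _),
    max_lt (max_lt one_pos hm) (by linarith), le_max_of_le_left (le_max_right _ _), ?_⟩
  intro γ h1 h2
  have h3 := (le_max_right (max 0 m) (1 - δ / 2)).trans h1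
  have h4 := h (x := γ) (by rw [Real.dist_eq, abs_lt]; constructor <;> linarith)
  rw [Real.dist_eq] at h4
  simpa using lt_of_abs_lt h4

end PhaseBounds

theorem mainTheorem5 (n : ℕ) (hn : 2 ≤ n) (w : ℝ) (hw : 1 < w)
    (hτ : w + 1 / w - loopPathTau n w > 2)
    (p : ℝ → ℝ) (hp : p = loopPathFidelity n w ⟨0, by omega⟩ ⟨n - 1, by omega⟩)
    (α : ℝ → ℝ)
    (hα : α = fun t =>
      t * (loopPathEigenvalue n w ⟨0, by omega⟩ - loopPathEigenvalue n w ⟨1, by omega⟩))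
    (b₁ b₂ : ℝ) (hb₁ : b₁ = loopPathB n (w + 1 / w))
    (hb₂ : b₂ = loopPathB n (w + 1 / w - loopPathTau n w)) :
    (∀ t γ : ℝ, 0 < t → 1 - b₁ - b₂ ≤ γ → p t = γ ^ 2 →
      Real.cos (α t) ≤
          -1 + (1 - γ) * ((b₁ + b₂) / (b₁ * b₂)) - (1 - γ) ^ 2 / (2 * b₁ * b₂) ∧
      (∃ (k : ℕ) (z : ℝ), |z| ≤ Real.pi ∧ α t = (2 * k + 1) * Real.pi + z) ∧
      ∀ (k : ℕ) (z : ℝ), |z| ≤ Real.pi → α t = (2 * k + 1) * Real.pi + z →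
        0 ≤ 1 - (1 - γ) * ((b₁ + b₂) / (b₁ * b₂)) + (1 - γ) ^ 2 / (2 * b₁ * b₂) →
        |z| ≤ Real.arccos
          (1 - (1 - γ) * ((b₁ + b₂) / (b₁ * b₂)) + (1 - γ) ^ 2 / (2 * b₁ * b₂))) ∧
    (∀ ε : ℝ, 0 < ε → ∃ γ₀ : ℝ, 0 ≤ γ₀ ∧ γ₀ < 1 ∧ ∀ t : ℝ, 0 < t → γ₀ ^ 2 ≤ p t →
      ∃ k : ℕ, |α t - (2 * k + 1) * Real.pi| < ε) := by
 
  obtain ⟨K, rfl⟩ : ∃ K, n = K + 2 := ⟨n - 2, by omega⟩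
  have hx2 : 2 < w + 1 / w - loopPathTau (K + 2) w := hτ
  have hx1 : w + 1 / w - loopPathTau (K + 2) w ≤ w + 1 / w := by
    linarith [loopPathTau_nonneg (n := K + 2) hw]
  have hb1 : 0 < b₁ := hb₁ ▸ loopPathB_pos hn (hx2.trans_le hx1)
  have hb2 : 0 < b₂ := hb₂ ▸ loopPathB_pos hn hx2
  -- The bounds by `1/2` give `1 - b₁ - b₂ ≥ 0`, so an admissible `γ` is nonnegative and equals the
  -- norm of the amplitude.
  have hb1' : b₁ ≤ 1 / 2 := hb₁ ▸ loopPathB_le_half hn (hx2.trans_le hx1)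
  have hb2' : b₂ ≤ 1 / 2 := hb₂ ▸ loopPathB_le_half hn hx2
  have hb21 : b₂ ≤ b₁ := by
    rw [hb₁, hb₂]
    exact loopPathB_mono hn hx2 hx1
  have hα' : ∀ t, α t = t * loopPathEigenvalue (K + 2) w 0 -
      t * loopPathEigenvalue (K + 2) w 1 := fun t => by
    rw [hα, ← mul_sub]
    rfl
  have hα0 : ∀ t, 0 < t → 0 ≤ α t := fun t ht => by
    rw [hα', ← mul_sub]
    exact mul_nonneg ht.le
      (sub_nonneg.mpr (loopPathEigenvalue_antitone (K + 2) w (Fin.zero_le 1)))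
  have hamp : ∀ t γ : ℝ, 0 ≤ γ → p t = γ ^ 2 → ∃ r : ℝ, 0 ≤ r ∧
      r ^ 2 = b₁ ^ 2 + b₂ ^ 2 - 2 * b₁ * b₂ * Real.cos (α t) ∧ γ ≤ r + (1 - b₁ - b₂) := by
    intro t γ hγ hp'
    have h1 : ‖loopPathTransition (K + 2) w t 0 (Fin.last (K + 1))‖ = γ := by
      refine (pow_left_inj₀ (norm_nonneg _) hγ two_ne_zero).mp ?_
      rw [← hp', hp]
      rfl
    have h2 := norm_loopPathTransition_le K hw t
    rw [h1, ← hb₁] at h2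
    refine ⟨_, norm_nonneg _, ?_, h2.trans (norm_sub_mul_exp_add_le le_rfl hb21 _ _)⟩
    rw [norm_sub_mul_exp_sq, hα']
  have hcos : ∀ t γ : ℝ, 1 - b₁ - b₂ ≤ γ → p t = γ ^ 2 → Real.cos (α t) ≤
      -1 + (1 - γ) * ((b₁ + b₂) / (b₁ * b₂)) - (1 - γ) ^ 2 / (2 * b₁ * b₂) := by
    intro t γ hγ hp'
    obtain ⟨r, -, hr, hle⟩ := hamp t γ (by linarith) hp'
    exact cos_le_of_amplitude_le hb1 hb2 hγ hr hle
  refine ⟨fun t γ ht hγ hp' => ⟨hcos t γ hγ hp', exists_eq_odd_mul_pi_add (hα0 t ht),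
    fun k z hz hk _ => abs_le_arccos_of_cos_le hz hk (by linarith [hcos t γ hγ hp'])⟩, ?_⟩
  intro ε hε
  obtain ⟨γ₀, h0, h1, hm, h⟩ := exists_arccos_lt (C := (b₁ + b₂) / (b₁ * b₂))
    (D := 2 * b₁ * b₂) (m := 1 - b₁ - b₂) hε (by linarith)
  refine ⟨γ₀, h0, h1, fun t ht hpt => ?_⟩
  have hp0 : p t = √(p t) ^ 2 := (Real.sq_sqrt ((sq_nonneg _).trans hpt)).symm
  have hγ : γ₀ ≤ √(p t) := Real.le_sqrt_of_sq_le hpt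
  obtain ⟨r, hr0, hr, hle⟩ := hamp t _ (Real.sqrt_nonneg _) hp0
  -- This yields `√(p t) ≤ 1`, the upper limit required in the choice of `γ₀`.
  have hr1 : r ≤ b₁ + b₂ := by
    refine abs_le_of_sq_le_sq' ?_ (by linarith) |>.2
    rw [hr]
    nlinarith [Real.neg_one_le_cos (α t), mul_pos hb1 hb2]
  obtain ⟨k, z, hz, hk⟩ := exists_eq_odd_mul_pi_add (hα0 t ht)
  refine ⟨k, ?_⟩
  rw [hk, add_sub_cancel_left]
  exact (abs_le_arccos_of_cos_le hz hk
    (by linarith [hcos t _ (hm.trans hγ) hp0])).trans_lt (h _ hγ (by linarith))
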